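/- Let $N$ be a finite non-empty set with $n=|N|$, and let $w$ be a supermodular game over $N$, that is, a function from the subsets of $N$ to $\mathbb{R}$ with $w(\emptyset)=0$ and $w(D\cup E)+w(D\cap E)\ge w(D)+w(E)$ for all $D,E\subseteq N$. Its core is the polytope $\mathrm{core}(w)=\{z\in\mathbb{R}^N : \sum_{\ell\in N}z_\ell=w(N),\ \sum_{\ell\in S}z_\ell\ge w(S)\text{ for all }S\subseteq N\}$. An enumeration of $N$ is a bijection $\sigma:\{1,\dots,n\}\to N$; its Weyl chamber is $\mathsf{N}^\sigma=\{x\in\mathbb{R}^N : x_{\sigma(1)}\le\dots\le x_{\sigma(n)}\}$, and its marginal vector $m^w(\sigma)\in\mathbb{R}^N$ is given by $m^w(\sigma)_{\sigma(i)}=w(\{\sigma(1),\dots,\sigma(i)\})-w(\{\sigma(1),\dots,\sigma(i-1)\})$ for $i=1,\dots,n$. For $A\subseteq N$ let $\chi_A\in\mathbb{R}^N$ be its incidence vector, and write $\chi_u=\chi_{\{u\}}$. Write $\mathrm{tr}$ for the transitive closure of a relation. Let $y$ be a vertex of $\mathrm{core}(w)$, let $\mathsf{N}(y)=\{x\in\mathbb{R}^N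 : \langle x,y-z\rangle\ge 0\text{ for all }z\in\mathrm{core}(w)\}$ be the outer normal cone to $\mathrm{core}(w)$ at $y$, let $S=\{\sigma : m^w(\sigma)=y\}$, and let $T=\{(u,v)\in N\times N : \sigma^{-1}(u)\le\sigma^{-1}(v)\text{ for all }\sigma\in S\}$. Then: (a) if $\sigma$ is an enumeration of $N$ with $m^w(\sigma)=y$, then $\mathsf{N}^\sigma\subseteq\mathsf{N}(y)$; (b) if $\tau$ is an enumeration of $N$ with $m^w(\tau)\ne y$, then $\mathrm{int}(\mathsf{N}^\tau)\cap\mathsf{N}(y)=\emptyset$; (c) $\mathsf{N}(y)=\bigcup_{\sigma\in S}\mathsf{N}^\sigma$; (d) $T$ is a partial order on $N$, and $\mathsf{N}(y)$ is its braid cone: $\mathsf{N}(y)=\{x\in\mathbb{R}^N : x_u\le x_v\text{ for all }(u,v)\in T\}$; (e) $T=\mathrm{tr}(R)$, where $R$ is the set of pairs $(u,v)\in N\times N$ for which there are a vertex $z$ of $\mathrm{core}(w)$ and a real $k>0$ with $z-y=k(\chi_u-\chi_v)$; (f) $T=\mathrm{tr}(R_{\min}\cup\{(u,u):u\in N\})$,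 where $R_{\min}$ is the set of pairs $(u,v)\in N\times N$ for which there are a vertex $z\neq y$ of $\mathrm{core}(w)$ such that the segment $[y,z]$ is an edge of $\mathrm{core}(w)$, and a real $k>0$, with $z-y=k(\chi_u-\chi_v)$. -/

import Mathlib

namespace CoreGame

variable {N : Type*} [Fintype N] [DecidableEq N]

/-- A supermodular game over `N`: a set function vanishing at the empty set and satisfying
the supermodular inequalities. -/
def IsSupermodularGame (w : Finset N → ℝ) : Prop :=
  w ∅ = 0 ∧ ∀ D E : Finset N, w D + w E ≤ w (D ∪ E) + w (D ∩ E)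

/-- The core of a game. -/
def core (w : Finset N → ℝ) : Set (N → ℝ) :=
  {z | ∑ l, z l = w Finset.univ ∧ ∀ S : Finset N, w S ≤ ∑ l ∈ S, z l}

/-- An enumeration of `N`: a bijection from the ordered set of positions onto `N`. -/
abbrev Enumeration (N : Type*) [Fintype N] := Fin (Fintype.card N) ≃ N

/-- The marginal vector of the game `w` for the enumeration `σ`: the component at `l` is the
increment of `w` when `l` is added to the set of the elements listed before it. -/
def marginalVector (w : Finset N → ℝ) (σ : Enumeration N) : N → ℝ := fun l =>
  w (Finset.univ.filter fun m => σ.symm m ≤ σ.symm l)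
    - w (Finset.univ.filter fun m => σ.symm m < σ.symm l)

/-- The set of enumerations whose marginal vector is `y`. -/
def marginalFiber (w : Finset N → ℝ) (y : N → ℝ) : Set (Enumeration N) :=
  {σ | marginalVector w σ = y}

/-- The outer normal cone to `P` at `y`. -/
def normalCone (P : Set (N → ℝ)) (y : N → ℝ) : Set (N → ℝ) :=
  {x | ∀ z ∈ P, 0 ≤ x ⬝ᵥ (y - z)}

/-- The Weyl chamber of an enumeration: `x (σ 1) ≤ x (σ 2) ≤ … ≤ x (σ n)`. -/
def weylChamber (σ : Enumeration N) : Set (N → ℝ) :=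
  {x | ∀ i j, i ≤ j → x (σ i) ≤ x (σ j)}

/-- The braid cone of a binary relation on `N`. -/
def braidCone (T : Set (N × N)) : Set (N → ℝ) :=
  {x | ∀ p ∈ T, x p.1 ≤ x p.2}

/-- The pairs `(u, v)` such that `u` weakly precedes `v` in every enumeration from `S`. -/
def commonPrecedence (S : Set (Enumeration N)) : Set (N × N) :=
  {p | ∀ σ ∈ S, σ.symm p.1 ≤ σ.symm p.2}

/-- `T` is (the graph of) a partial order on `N`. -/
def IsPoset (T : Set (N × N)) : Prop :=
  (∀ u, (u, u) ∈ T) ∧ (∀ u v, (u, v) ∈ T → (v, u) ∈ T → u = v) ∧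
    ∀ u v t, (u, v) ∈ T → (v, t) ∈ T → (u, t) ∈ T

/-- The transitive closure of a binary relation. -/
def transClosure (R : Set (N × N)) : Set (N × N) :=
  {p | Relation.TransGen (fun u v => (u, v) ∈ R) p.1 p.2}

/-- The incidence vector of a subset. -/
def incidence (A : Finset N) : N → ℝ := fun l => if l ∈ A then 1 else 0

/-- The geometric neighbours of `y` in `P`: the vertices `z ≠ y` for which the segment `[y, z]` is
a face (that is, an edge) of `P`. -/
def neighbours (P : Set (N → ℝ)) (y : N → ℝ) : Set (N → ℝ) :=
  {z | z ∈ P.extremePoints ℝ ∧ z ≠ y ∧ IsExtreme ℝ P (segment ℝ y z)}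

/-- The pairs `(u, v)` for which some `z ∈ Z` differs from `y` by a positive multiple of
`χ_u - χ_v`. -/
def directionPairs (Z : Set (N → ℝ)) (y : N → ℝ) : Set (N × N) :=
  {p | ∃ z ∈ Z, ∃ k : ℝ, 0 < k ∧ z - y = k • (incidence {p.1} - incidence {p.2})}

end CoreGame

open CoreGame

/-! Everything is read off from the sets tight at `y`. Supermodularity makes them a lattice, so they
are exactly the down-sets of the preorder `TightLE` (`isTight_of_downClosed`); since `y` is a
vertex, this preorder is antisymmetric.

By Abel summation, the Weyl chamber of an enumeration lies in the normal cone at its marginal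
vector. Conversely, a normal vector is monotone along `TightLE`, because the core contains short
steps from `y` in the direction `χ_u - χ_v` whenever `u` is below `v`. Sorting `N` by such a vector,
with ties broken by `TightLE`, gives an enumeration whose initial segments are tight, hence with
marginal vector `y`. This yields the decomposition into chambers, the braid cone, and the identity
of `TightLE` with the common precedence `T`.

For (e) and (f), a core point reached from `y` in the direction `χ_u - χ_v` forces `u` below `v`,
while every cover of `TightLE` spans an edge (`mem_directionPairs_neighbours_of_cover`). A finite
order is generated by its covers, so both closures equal `T`. -/

namespace CoreGame

section

variable {N : Type*} [Fintype N] [DecidableEq N]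

/-- A set is tight at `y` when its core inequality holds with equality. -/
def IsTight (w : Finset N → ℝ) (y : N → ℝ) (D : Finset N) : Prop := ∑ l ∈ D, y l = w D

/-- `u` belongs to every tight set containing `v`. -/
def TightLE (w : Finset N → ℝ) (y : N → ℝ) (u v : N) : Prop :=
  ∀ D, IsTight w y D → v ∈ D → u ∈ D

omit [Fintype N] [DecidableEq N] in
theorem TightLE.refl (w : Finset N → ℝ) (y : N → ℝ) (u : N) : TightLE w y u u :=
  fun _ _ h => h

omit [Fintype N] [DecidableEq N] in
theorem TightLE.trans {w : Finset N → ℝ} {y : N → ℝ} {u v t : N}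
    (huv : TightLE w y u v) (hvt : TightLE w y v t) : TightLE w y u t :=
  fun D hD ht => huv D hD (hvt D hD ht)

omit [Fintype N] in
theorem sum_smul_incidence_sub (D : Finset N) (k : ℝ) (u v : N) :
    ∑ l ∈ D, (k • (incidence {u} - incidence {v} : N → ℝ)) l =
      k * ((if u ∈ D then 1 else 0) - (if v ∈ D then 1 else 0)) := by
  simp [incidence, ← Finset.mul_sum, Finset.sum_sub_distrib]

omit [Fintype N] in
theorem sum_add_smul_incidence_sub (y : N → ℝ) (D : Finset N) (k : ℝ) (u v : N) :
    ∑ l ∈ D, (y + k • (incidence {u} - incidence {v} : N → ℝ)) l =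
      ∑ l ∈ D, y l + k * ((if u ∈ D then 1 else 0) - (if v ∈ D then 1 else 0)) := by
  rw [← sum_smul_incidence_sub, ← Finset.sum_add_distrib]
  rfl

/-! ### Marginal vectors and Abel summation over a Weyl chamber. -/

section Marginal

variable {w : Finset N → ℝ} {σ : Enumeration N}

theorem insert_filter_lt (a : N) :
    insert a (Finset.univ.filter fun m => σ.symm m < σ.symm a) =
      Finset.univ.filter fun m => σ.symm m ≤ σ.symm a := by
  ext m
  simp [le_iff_lt_or_eq, or_comm]

/-- The increments telescope: removing the last listed element of an initial segment leaves its set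
of strict predecessors. -/
theorem sum_marginalVector_eq (hw : IsSupermodularGame w) (S : Finset N)
    (hS : ∀ v ∈ S, ∀ u, σ.symm u ≤ σ.symm v → u ∈ S) :
    ∑ l ∈ S, marginalVector w σ l = w S := by
  induction S using Finset.induction_on_max_value σ.symm with
  | empty => simp [hw.1]
  | insert a s ha hmax ih =>
    have hlt : ∀ m ∈ s, σ.symm m < σ.symm a := fun m hm =>
      lt_of_le_of_ne (hmax m hm) (by simpa using (fun h => ha (h ▸ hm) : m ≠ a))
    have hs : s = Finset.univ.filter fun m => σ.symm m < σ.symm a := by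
      ext m
      refine ⟨fun hm => by simpa using hlt m hm, fun hm => ?_⟩
      rw [Finset.mem_filter] at hm
      exact Finset.mem_of_mem_insert_of_ne (hS a (Finset.mem_insert_self a s) m hm.2.le)
        (by rintro rfl; exact lt_irrefl _ hm.2)
    rw [Finset.sum_insert ha, ih]
    · rw [marginalVector, ← insert_filter_lt, ← hs]
      ring
    · intro v hv u huv
      exact Finset.mem_of_mem_insert_of_ne (hS v (Finset.mem_insert_of_mem hv) u huv)
        (by rintro rfl; exact absurd huv (not_le.2 (hlt v hv)))

/-- An enumeration all of whose initial segments are tight at `y` has marginal vector `y`. -/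
theorem marginalVector_eq_of_isTight {y : N → ℝ}
    (h : ∀ S : Finset N, (∀ v ∈ S, ∀ u, σ.symm u ≤ σ.symm v → u ∈ S) → IsTight w y S) :
    marginalVector w σ = y := by
  funext l
  have h1 := h (Finset.univ.filter fun m => σ.symm m ≤ σ.symm l) (by
    intro v hv u huv
    simp only [Finset.mem_filter, Finset.mem_univ, true_and] at hv ⊢
    exact huv.trans hv)
  have h2 := h (Finset.univ.filter fun m => σ.symm m < σ.symm l) (by
    intro v hv u huv
    simp only [Finset.mem_filter, Finset.mem_univ, true_and] at hv ⊢
    exact huv.trans_lt hv)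
  rw [IsTight, ← insert_filter_lt, Finset.sum_insert (by simp), insert_filter_lt] at h1
  rw [IsTight] at h2
  unfold marginalVector
  linarith

/-- Abel summation: a vector with nonpositive sums over the initial segments of `σ` pairs with
a vector of the Weyl chamber of `σ` to at least an upper bound times its total. -/
theorem mul_sum_le_sum_mul {x d : N → ℝ} (hx : x ∈ weylChamber σ) (S : Finset N)
    (hd : ∀ T ⊆ S, (∀ v ∈ T, ∀ u ∈ S, σ.symm u ≤ σ.symm v → u ∈ T) → ∑ l ∈ T, d l ≤ 0)
    (M : ℝ) (hM : ∀ l ∈ S, x l ≤ M) :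
    M * ∑ l ∈ S, d l ≤ ∑ l ∈ S, x l * d l := by
  induction S using Finset.induction_on_max_value σ.symm generalizing M with
  | empty => simp
  | insert a s ha hmax ih =>
    have hS := hd (insert a s) subset_rfl (fun _ _ u hu _ => hu)
    -- The last listed element has the largest coordinate, so `x a` serves as the bound for the
    -- remaining set. Replacing `x a` by `M` then costs `(M - x a)` times a nonpositive sum.
    have hs : x a * ∑ l ∈ s, d l ≤ ∑ l ∈ s, x l * d l := by
      apply ih
      · intro T hT hdown
        refine hd T (hT.trans (Finset.subset_insert a s)) ?_
        intro v hv u hu huv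
        rcases Finset.mem_insert.1 hu with rfl | hu
        · have : v = u := σ.symm.injective (le_antisymm (hmax v (hT hv)) huv)
          exact absurd (this ▸ hT hv) ha
        · exact hdown v hv u hu huv
      · intro l hl
        simpa using hx _ _ (hmax l hl)
    have hxa := hM a (Finset.mem_insert_self a s)
    rw [Finset.sum_insert ha] at hS ⊢
    rw [Finset.sum_insert ha]
    nlinarith [mul_nonneg (sub_nonneg.2 hxa) (neg_nonneg.2 hS)]

theorem weylChamber_subset_normalCone (hw : IsSupermodularGame w) :
    weylChamber σ ⊆ normalCone (core w) (marginalVector w σ) := by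
  intro x hx z hz
  -- Any upper bound of `x` will do, since the total of the difference vector is zero.
  obtain ⟨M, hM⟩ := Finset.exists_le (Finset.univ.image x)
  have h := mul_sum_le_sum_mul (d := marginalVector w σ - z) hx Finset.univ (by
    intro T _ hT
    have h1 := sum_marginalVector_eq hw T (fun v hv u huv => hT v hv u (Finset.mem_univ u) huv)
    have h2 := hz.2 T
    simp only [Pi.sub_apply, Finset.sum_sub_distrib]
    linarith) M (fun l _ => hM _ (Finset.mem_image_of_mem x (Finset.mem_univ l)))
  have h0 : ∑ l, (marginalVector w σ - z) l = 0 := by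
    simp only [Pi.sub_apply, Finset.sum_sub_distrib, hz.1,
      sum_marginalVector_eq hw Finset.univ (fun _ _ u _ => Finset.mem_univ u), sub_self]
  rw [h0, mul_zero] at h
  exact h

end Marginal

/-! ### Interiors of Weyl chambers. -/

section Interior

variable {τ : Enumeration N} {x : N → ℝ}

/-- Raising the coordinate at `τ i` slightly does not leave the chamber, so the inequality had
slack. -/
theorem lt_of_mem_interior_weylChamber (hx : x ∈ interior (weylChamber τ))
    {i j : Fin (Fintype.card N)} (hij : i < j) : x (τ i) < x (τ j) := by
  have hc : Filter.Tendsto (fun t : ℝ => x + t • (Pi.single (τ i) 1 : N → ℝ))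
      (nhdsWithin 0 (Set.Ioi 0)) (nhds x) := by
    have : Continuous (fun t : ℝ => x + t • (Pi.single (τ i) 1 : N → ℝ)) := by fun_prop
    simpa using (this.tendsto 0).mono_left nhdsWithin_le_nhds
  obtain ⟨t, ht, ht0⟩ := ((hc.eventually (mem_interior_iff_mem_nhds.1 hx)).and
    self_mem_nhdsWithin).exists
  have h := ht i j hij.le
  have hne : τ j ≠ τ i := by simpa using hij.ne'
  simp [hne] at h
  have : (0 : ℝ) < t := ht0
  linarith

/-- An interior point has distinct coordinates, so only one enumeration sorts it. -/
theorem marginalVector_eq_of_mem_interior (w : Finset N → ℝ) {σ : Enumeration N}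
    (hx : x ∈ interior (weylChamber τ)) (hσ : x ∈ weylChamber σ) :
    marginalVector w τ = marginalVector w σ := by
  have hlt : ∀ u v, τ.symm u < τ.symm v → σ.symm u < σ.symm v := by
    intro u v huv
    by_contra hcon
    have h1 := lt_of_mem_interior_weylChamber hx huv
    have h2 := hσ _ _ (not_lt.1 hcon)
    simp only [Equiv.apply_symm_apply] at h1 h2
    linarith
  have hiff : ∀ u v, σ.symm u < σ.symm v ↔ τ.symm u < τ.symm v := by
    refine fun u v => ⟨fun h => ?_, hlt u v⟩
    by_contra hcon
    rcases (not_lt.1 hcon).lt_or_eq with h' | h'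
    · exact lt_asymm h (hlt _ _ h')
    · rw [τ.symm.injective h'] at h
      exact lt_irrefl _ h
  have hiff' : ∀ u v, σ.symm u ≤ σ.symm v ↔ τ.symm u ≤ τ.symm v := fun u v => by
    rw [← not_lt, ← not_lt, hiff]
  funext l
  simp only [marginalVector, hiff, hiff']

end Interior

/-! ### Tight sets, the tight order and the normal cone. -/

section Tight

variable {w : Finset N → ℝ} {y : N → ℝ}

/-- The excesses of union and intersection are nonnegative, and by supermodularity their sum is at
most zero. -/
theorem IsTight.union_inter (hw : IsSupermodularGame w) (hy : y ∈ core w) {D E : Finset N}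
    (hD : IsTight w y D) (hE : IsTight w y E) :
    IsTight w y (D ∪ E) ∧ IsTight w y (D ∩ E) := by
  have h := Finset.sum_union_inter (s₁ := D) (s₂ := E) (f := y)
  have h1 := hy.2 (D ∪ E)
  have h2 := hy.2 (D ∩ E)
  have h3 := hw.2 D E
  unfold IsTight at *
  constructor <;> linarith

omit [Fintype N] in
theorem isTight_empty (hw : IsSupermodularGame w) : IsTight w y ∅ := by
  simp [IsTight, hw.1]

/-- Each `v` has a least tight set `hull v`, the intersection of all tight sets containing it, which
is the principal down-set of `v`. A down-set is the union of the hulls of its elements. -/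
theorem isTight_of_downClosed (hw : IsSupermodularGame w) (hy : y ∈ core w) {D : Finset N}
    (hD : ∀ v ∈ D, ∀ u, TightLE w y u v → u ∈ D) : IsTight w y D := by
  classical
  let hull : N → Finset N := fun v =>
    (Finset.univ.filter fun E => IsTight w y E ∧ v ∈ E).inf id
  have hhull : ∀ v, IsTight w y (hull v) := fun v =>
    Finset.inf_induction (p := IsTight w y) hy.1
      (fun _ h1 _ h2 => (h1.union_inter hw hy h2).2)
      (fun E hE => (Finset.mem_filter.1 hE).2.1)
  have hmem : ∀ u v, u ∈ hull v ↔ TightLE w y u v := by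
    intro u v
    simp only [hull, Finset.mem_inf, Finset.mem_filter, Finset.mem_univ, true_and, id, TightLE,
      and_imp]
  have : D = D.sup hull := by
    ext u
    simp only [Finset.mem_sup, hmem]
    exact ⟨fun hu => ⟨u, hu, TightLE.refl w y u⟩, fun ⟨v, hv, huv⟩ => hD v hv u huv⟩
  rw [this]
  exact Finset.sup_induction (p := IsTight w y) (isTight_empty hw)
    (fun _ h1 _ h2 => (h1.union_inter hw hy h2).1) (fun v _ => hhull v)

/-- From `y` one can move inside the core in the direction `χ_u - χ_v` when every tight set
containing `v` contains `u`; if moreover `u ≠ v`, then there is a largest admissible step. -/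
theorem exists_max_step (hy : y ∈ core w) {u v : N} (huv : TightLE w y u v) (hne : u ≠ v) :
    ∃ k : ℝ, 0 < k ∧ ∀ c : ℝ, 0 ≤ c →
      (y + c • (incidence {u} - incidence {v}) ∈ core w ↔ c ≤ k) := by
  -- Only sets containing `v` but not `u` lose weight along the move; the largest step is their
  -- least excess, which is positive because none of them is tight.
  obtain ⟨D, hD, hmin⟩ := Finset.exists_min_image
    (Finset.univ.filter fun D : Finset N => v ∈ D ∧ u ∉ D)
    (fun D => ∑ l ∈ D, y l - w D) ⟨{v}, by simpa using hne⟩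
  simp only [Finset.mem_filter, Finset.mem_univ, true_and] at hD hmin
  refine ⟨∑ l ∈ D, y l - w D, ?_, fun c hc => ⟨fun h => ?_, fun h => ⟨?_, fun E => ?_⟩⟩⟩
  · refine lt_of_le_of_ne (sub_nonneg.2 (hy.2 D)) fun h => ?_
    exact hD.2 (huv D (sub_eq_zero.1 h.symm) hD.1)
  · have := h.2 D
    rw [sum_add_smul_incidence_sub] at this
    simp only [hD.1, hD.2, if_true, if_false] at this
    linarith
  · rw [sum_add_smul_incidence_sub]
    simp [hy.1]
  · rw [sum_add_smul_incidence_sub]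
    have hE := hy.2 E
    by_cases hu : u ∈ E <;> by_cases hv : v ∈ E
    · simpa [hu, hv] using hE
    · simp only [hu, hv, if_true, if_false]
      linarith
    · have := hmin E ⟨hv, hu⟩
      simp only [hu, hv, if_true, if_false]
      linarith
    · simpa [hu, hv] using hE

omit [Fintype N] in
theorem incidence_sub_apply_left {u v : N} (hne : u ≠ v) :
    (incidence {u} - incidence {v} : N → ℝ) u = 1 := by
  simp [incidence, hne]

/-- Otherwise `y` would be the midpoint of two core points, reached by opposite equal steps. -/
theorem TightLE.antisymm (hy : y ∈ (core w).extremePoints ℝ) {u v : N}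
    (huv : TightLE w y u v) (hvu : TightLE w y v u) : u = v := by
  by_contra hne
  obtain ⟨k, hk, hkmem⟩ := exists_max_step hy.1 huv hne
  obtain ⟨l, hl, hlmem⟩ := exists_max_step hy.1 hvu (Ne.symm hne)
  have hc : 0 < min k l := lt_min hk hl
  have h1 := (hkmem _ hc.le).2 (min_le_left k l)
  have h2 := (hlmem _ hc.le).2 (min_le_right k l)
  have h := hy.2 h1 h2 ⟨1 / 2, 1 / 2, by norm_num, by norm_num, by norm_num, by
    funext m
    simp only [Pi.add_apply, Pi.smul_apply, Pi.sub_apply, smul_eq_mul]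
    ring⟩
  have := congrFun h u
  rw [Pi.add_apply, Pi.smul_apply, incidence_sub_apply_left hne, smul_eq_mul, mul_one] at this
  linarith

theorem le_of_mem_normalCone (hy : y ∈ core w) {x : N → ℝ} (hx : x ∈ normalCone (core w) y)
    {u v : N} (huv : TightLE w y u v) : x u ≤ x v := by
  by_cases hne : u = v
  · rw [hne]
  obtain ⟨k, hk, hkmem⟩ := exists_max_step hy huv hne
  have h := hx _ ((hkmem k hk.le).2 le_rfl)
  have he : x ⬝ᵥ (y - (y + k • (incidence {u} - incidence {v}))) = k * (x v - x u) := by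
    rw [sub_add_cancel_left, dotProduct_neg, dotProduct_smul, dotProduct_sub]
    simp [dotProduct, incidence]
    ring
  rw [he] at h
  exact sub_nonneg.1 (nonneg_of_mul_nonneg_right h hk)

/-- A vector monotone along the tight order lies in the Weyl chamber of an enumeration with
marginal vector `y`. -/
theorem exists_enumeration_of_monotone (hw : IsSupermodularGame w)
    (hy : y ∈ (core w).extremePoints ℝ) {x : N → ℝ}
    (hx : ∀ u v, TightLE w y u v → x u ≤ x v) :
    ∃ σ ∈ marginalFiber w y, x ∈ weylChamber σ := by
  -- Order by the value of `x`, with ties broken by the tight order. Any linear extension sorts `x`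
  -- and, by monotonicity of `x`, refines the tight order.
  let r : N → N → Prop := fun u v => x u < x v ∨ (x u = x v ∧ TightLE w y u v)
  have : IsPartialOrder N r :=
    { refl := fun u => Or.inr ⟨rfl, TightLE.refl w y u⟩
      trans := by
        rintro u v t (h1 | ⟨h1, h1'⟩) (h2 | ⟨h2, h2'⟩)
        · exact Or.inl (h1.trans h2)
        · exact Or.inl (h2 ▸ h1)
        · exact Or.inl (h1 ▸ h2)
        · exact Or.inr ⟨h1.trans h2, h1'.trans h2'⟩
      antisymm := by
        rintro u v (h1 | ⟨h1, h1'⟩) (h2 | ⟨h2, h2'⟩)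
        · exact absurd h1 (lt_asymm h2)
        · exact absurd h2.symm h1.ne
        · exact absurd h1.symm h2.ne
        · exact h1'.antisymm hy h2' }
  obtain ⟨s, hs, hrs⟩ := extend_partialOrder r
  classical
  let L : LinearOrder N :=
    { le := s
      le_refl := hs.refl
      le_trans := hs.trans
      le_antisymm := hs.antisymm
      le_total := hs.total
      toDecidableLE := Classical.decRel _ }
  let e : Fin (Fintype.card N) ≃o N := monoEquivOfFin N rfl
  have he : ∀ u v, r u v → e.symm u ≤ e.symm v := fun u v h => e.symm.monotone (hrs u v h)
  have hxle : ∀ u v, TightLE w y u v → r u v := fun u v h =>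
    (hx u v h).lt_or_eq.imp id fun h' => ⟨h', h⟩
  refine ⟨e.toEquiv, marginalVector_eq_of_isTight fun S hS => ?_, fun i j hij => ?_⟩
  · exact isTight_of_downClosed hw hy.1 fun v hv u huv => hS v hv u (he u v (hxle u v huv))
  · by_contra hcon
    have h := he _ _ (Or.inl (not_le.1 hcon))
    simp only [OrderIso.coe_toEquiv, OrderIso.symm_apply_apply] at h
    rw [le_antisymm hij h] at hcon
    exact hcon le_rfl

theorem tightLE_iff_forall_le (hw : IsSupermodularGame w) (hy : y ∈ (core w).extremePoints ℝ)
    {u v : N} : TightLE w y u v ↔ ∀ σ ∈ marginalFiber w y, σ.symm u ≤ σ.symm v := by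
  constructor
  · intro h σ hσ
    have ht : IsTight w y (Finset.univ.filter fun m => σ.symm m ≤ σ.symm v) := by
      have hσ' : marginalVector w σ = y := hσ
      rw [IsTight, ← hσ']
      refine sum_marginalVector_eq hw _ fun a ha b hba => ?_
      simp only [Finset.mem_filter, Finset.mem_univ, true_and] at ha ⊢
      exact hba.trans ha
    simpa using h _ ht (by simp)
  · intro h D hD hv
    by_contra hu
    -- The indicator of the complement of a tight `D` is monotone along the tight order. An
    -- enumeration sorting it lists all of `D` first, so `u` cannot precede `v`.
    obtain ⟨σ, hσ, hx⟩ := exists_enumeration_of_monotone (x := fun l => if l ∈ D then 0 else 1)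
      hw hy (by
        intro a b hab
        by_cases hb : b ∈ D
        · simp [hb, hab D hD hb]
        · simp only [hb, if_false]
          split_ifs <;> norm_num)
    have := hx _ _ (h σ hσ)
    simp only [Equiv.apply_symm_apply, hv, hu, if_true, if_false] at this
    norm_num at this

theorem normalCone_core_eq_iUnion (hw : IsSupermodularGame w)
    (hy : y ∈ (core w).extremePoints ℝ) :
    normalCone (core w) y = ⋃ σ ∈ marginalFiber w y, weylChamber σ := by
  ext x
  simp only [Set.mem_iUnion, exists_prop]
  constructor
  · intro hx
    exact exists_enumeration_of_monotone hw hy fun u v huv => le_of_mem_normalCone hy.1 hx huv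
  · rintro ⟨σ, rfl, hx⟩
    exact weylChamber_subset_normalCone hw hx

theorem normalCone_core_eq_braidCone (hw : IsSupermodularGame w)
    (hy : y ∈ (core w).extremePoints ℝ) :
    normalCone (core w) y = braidCone (commonPrecedence (marginalFiber w y)) := by
  apply Set.Subset.antisymm
  · intro x hx p hp
    exact le_of_mem_normalCone hy.1 hx ((tightLE_iff_forall_le hw hy).2 hp)
  · intro x hx
    rw [normalCone_core_eq_iUnion hw hy]
    simp only [Set.mem_iUnion, exists_prop]
    exact exists_enumeration_of_monotone hw hy fun u v huv =>
      hx (u, v) ((tightLE_iff_forall_le hw hy).1 huv)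

/-! ### Edge directions at a vertex and covers of the tight order. -/

theorem tightLE_of_mem_directionPairs {Z : Set (N → ℝ)} (hZ : Z ⊆ core w) {u v : N}
    (h : (u, v) ∈ directionPairs Z y) : TightLE w y u v := by
  obtain ⟨z, hz, k, hk, hzy⟩ := h
  intro D hD hv
  by_contra hu
  have h1 := (hZ hz).2 D
  -- The step lowers the sum over `D` by `k`, below the bound already attained at `y`.
  rw [sub_eq_iff_eq_add'.1 hzy, sum_add_smul_incidence_sub, hD] at h1
  simp only [hu, hv, if_true, if_false] at h1
  linarith

omit [Fintype N] [DecidableEq N] in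
theorem transGen_tightLE {R : Set (N × N)} (hR : ∀ u v, (u, v) ∈ R → TightLE w y u v) {u v : N}
    (h : (u, v) ∈ transClosure R) : TightLE w y u v := by
  have h' : Relation.TransGen (fun a b => (a, b) ∈ R) u v := h
  clear h
  induction h' with
  | single h => exact hR _ _ h
  | tail _ hbc ih => exact ih.trans (hR _ _ hbc)

/-- A vector with the same sums as `y` over the tight sets not separating `u` from `v`,
for a cover `u ⋖ v` of the tight order, lies on the line through `y` in the direction
`χ_u - χ_v`. -/
theorem exists_eq_add_smul_of_cover (hw : IsSupermodularGame w)
    (hy : y ∈ core w)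
    (hanti : ∀ a b, TightLE w y a b → TightLE w y b a → a = b) {u v : N} (hne : u ≠ v)
    (hcov : ∀ t, TightLE w y u t → TightLE w y t v → t = u ∨ t = v)
    {q : N → ℝ} (hq : ∀ D, IsTight w y D → (u ∈ D → v ∈ D) → IsTight w q D) :
    ∃ c : ℝ, q = y + c • (incidence {u} - incidence {v}) := by
  classical
  have hpt : ∀ l, l ≠ u → l ≠ v → q l = y l := by
    intro l hlu hlv
    -- The down-set of `l`, enlarged by that of `v` when `u` is below `l`, so that `u ∈ D` implies
    -- `v ∈ D`. The cover condition keeps `l` maximal in `D`, so `D` and `D.erase l` are both tight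
    -- and their difference determines the coordinate at `l`.
    let D : Finset N := Finset.univ.filter fun m =>
      TightLE w y m l ∨ (TightLE w y u l ∧ TightLE w y m v)
    have hmem : ∀ m, m ∈ D ↔ TightLE w y m l ∨ (TightLE w y u l ∧ TightLE w y m v) := by
      simp [D]
    have hlD : l ∈ D := (hmem l).2 (Or.inl (TightLE.refl w y l))
    have hDv : u ∈ D → v ∈ D := by
      intro hu
      refine (hmem v).2 (Or.inr ⟨?_, TightLE.refl w y v⟩)
      rcases (hmem u).1 hu with h | h
      exacts [h, h.1]
    have hdown : ∀ b ∈ D, ∀ a, TightLE w y a b → a ∈ D := fun b hb a hab =>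
      (hmem a).2 (((hmem b).1 hb).imp hab.trans fun h => ⟨h.1, hab.trans h.2⟩)
    have hmax : ∀ m ∈ D, TightLE w y l m → m = l := by
      intro m hm hlm
      rcases (hmem m).1 hm with h | h
      · exact hanti _ _ h hlm
      · rcases hcov l h.1 (hlm.trans h.2) with h' | h'
        exacts [absurd h' hlu, absurd h' hlv]
    have ht := isTight_of_downClosed hw hy hdown
    have ht' : IsTight w y (D.erase l) := by
      refine isTight_of_downClosed hw hy fun b hb a hab => ?_
      rw [Finset.mem_erase] at hb ⊢
      exact ⟨by rintro rfl; exact hb.1 (hmax b hb.2 hab), hdown b hb.2 a hab⟩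
    have h1 := hq D ht hDv
    have h2 := hq (D.erase l) ht' fun hu =>
      Finset.mem_erase.2 ⟨hlv.symm, hDv (Finset.mem_of_mem_erase hu)⟩
    unfold IsTight at *
    rw [← Finset.add_sum_erase D _ hlD] at ht h1
    linarith
  refine ⟨q u - y u, ?_⟩
  have hsum : ∑ l, (q l - y l) = 0 := by
    rw [Finset.sum_sub_distrib, hy.1, hq Finset.univ hy.1 fun _ => Finset.mem_univ v, sub_self]
  rw [Finset.sum_eq_add u v hne
    (fun l _ h => by rw [hpt l h.1 h.2, sub_self]) (by simp) (by simp)] at hsum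
  funext l
  by_cases hlu : l = u
  · subst hlu
    simp [incidence, hne]
  by_cases hlv : l = v
  · subst hlv
    simp [incidence, hlu]
    linarith
  · simp [incidence, hlu, hlv, hpt l hlu hlv]

omit [DecidableEq N] in
-- Equality in a convex combination with positive weights forces equality at each endpoint.
theorem IsTight.of_mem_openSegment {p a b : N → ℝ} {D : Finset N} (hp : IsTight w p D)
    (ha : a ∈ core w) (hb : b ∈ core w) (h : p ∈ openSegment ℝ a b) : IsTight w a D := by
  obtain ⟨s, t, hs, ht, hst, rfl⟩ := h
  have h1 := ha.2 D
  have h2 := hb.2 D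
  simp only [IsTight, Pi.add_apply, Pi.smul_apply, smul_eq_mul, Finset.sum_add_distrib,
    ← Finset.mul_sum] at hp ⊢
  refine le_antisymm ?_ h1
  have hwd : w D = s * w D + t * w D := by rw [← add_mul, hst, one_mul]
  by_contra hcon
  nlinarith [mul_lt_mul_of_pos_left (not_le.1 hcon) hs, mul_le_mul_of_nonneg_left h2 ht.le]

/-- Every cover of the tight order at a vertex is the direction of an edge of the core. -/
theorem mem_directionPairs_neighbours_of_cover (hw : IsSupermodularGame w)
    (hy : y ∈ (core w).extremePoints ℝ) {u v : N} (huv : TightLE w y u v) (hne : u ≠ v)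
    (hcov : ∀ t, TightLE w y u t → TightLE w y t v → t = u ∨ t = v) :
    (u, v) ∈ directionPairs (neighbours (core w) y) y := by
  classical
  obtain ⟨k, hk, hkmem⟩ := exists_max_step hy.1 huv hne
  set e : N → ℝ := incidence {u} - incidence {v} with he
  have heu : e u = 1 := incidence_sub_apply_left hne
  have hseg : segment ℝ y (y + k • e) = {q | ∃ c : ℝ, 0 ≤ c ∧ c ≤ k ∧ q = y + c • e} := by
    rw [segment_eq_image']
    ext q
    constructor
    · rintro ⟨θ, hθ, rfl⟩
      exact ⟨θ * k, mul_nonneg hθ.1 hk.le, mul_le_of_le_one_left hk.le hθ.2, by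
        simp [mul_smul]⟩
    · rintro ⟨c, hc0, hck, rfl⟩
      exact ⟨c / k, ⟨div_nonneg hc0 hk.le, (div_le_one hk).2 hck⟩, by
        simp [smul_smul, div_mul_cancel₀ _ hk.ne']⟩
  have hface : IsExtreme ℝ (core w) (segment ℝ y (y + k • e)) := by
    rw [hseg]
    constructor
    · rintro q ⟨c, hc0, hck, rfl⟩
      exact (hkmem c hc0).2 hck
    · rintro a ha b hb p ⟨c, hc0, hck, rfl⟩ hp
      -- Tight sets with `u ∈ D → v ∈ D` contain both or neither, so they stay tight at `p` and
      -- therefore at `a`. This confines `a` to the line through `y`.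
      obtain ⟨d, rfl⟩ := exists_eq_add_smul_of_cover hw hy.1 (fun _ _ => TightLE.antisymm hy) hne
        hcov (q := a) (by
          intro D hD huD
          refine IsTight.of_mem_openSegment ?_ ha hb hp
          rw [IsTight, sum_add_smul_incidence_sub, hD]
          by_cases hv : v ∈ D
          · simp [hv, huv D hD hv]
          · simp [hv, mt huD hv])
      -- The down-set of `u` is tight and contains `u` but not `v`, so its core inequality at `a`
      -- reads `0 ≤ d`.
      have hd0 : 0 ≤ d := by
        have ht : IsTight w y (Finset.univ.filter fun m => TightLE w y m u) :=
          isTight_of_downClosed hw hy.1 fun b hb a hab => by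
            simp only [Finset.mem_filter, Finset.mem_univ, true_and] at hb ⊢
            exact hab.trans hb
        have h := ha.2 (Finset.univ.filter fun m => TightLE w y m u)
        have hvu : ¬ TightLE w y v u := fun h => hne (huv.antisymm hy h)
        rw [sum_add_smul_incidence_sub, ht] at h
        simpa [TightLE.refl, hvu] using h
      exact ⟨d, hd0, (hkmem d hd0).1 ha, rfl⟩
  refine ⟨y + k • e, ⟨⟨hface.subset (right_mem_segment ℝ _ _), ?_⟩, ?_, hface⟩, k, hk,
    add_sub_cancel_left _ _⟩
  -- The far endpoint is extreme: the face property puts `a` and `b` on the segment, where the step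
  -- length is at most `k`, and an average with positive weights equals `k` only if both lengths do.
  · intro a ha b hb hab
    have hz := right_mem_segment ℝ y (y + k • e)
    have ha' := hface.left_mem_of_mem_openSegment ha hb hz hab
    have hb' := hface.right_mem_of_mem_openSegment ha hb hz hab
    rw [hseg] at ha' hb'
    obtain ⟨c, _, hck, rfl⟩ := ha'
    obtain ⟨d, _, hdk, rfl⟩ := hb'
    obtain ⟨s, t, hs, ht, hst, hsum⟩ := hab
    have hu := congrFun hsum u
    simp only [Pi.add_apply, Pi.smul_apply, heu, smul_eq_mul, mul_one] at hu
    have hck' : c = k := by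
      refine le_antisymm hck (not_lt.1 fun hlt => ?_)
      have h1 : t = 1 - s := by linarith
      subst h1
      nlinarith [mul_lt_mul_of_pos_left hlt hs, mul_le_mul_of_nonneg_left hdk ht.le]
    rw [hck']
  · intro h
    have := congrFun h u
    simp only [Pi.add_apply, Pi.smul_apply, heu, smul_eq_mul, mul_one] at this
    linarith

theorem mem_transClosure_neighbours_of_tightLE (hw : IsSupermodularGame w)
    (hy : y ∈ (core w).extremePoints ℝ) {u v : N} (huv : TightLE w y u v) :
    (u, v) ∈ transClosure (directionPairs (neighbours (core w) y) y ∪ Set.diagonal N) := by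
  classical
  let P : PartialOrder N :=
    { le := TightLE w y
      le_refl := TightLE.refl w y
      le_trans := fun _ _ _ => TightLE.trans
      le_antisymm := fun _ _ => TightLE.antisymm hy }
  let F : LocallyFiniteOrder N := Fintype.toLocallyFiniteOrder
  have huv' : u ≤ v := huv
  rcases huv'.eq_or_lt with rfl | hlt
  · exact Relation.TransGen.single (Or.inr rfl)
  -- In a finite order every strict relation is a chain of covers.
  · refine Relation.TransGen.mono (fun a b hab => Or.inl ?_) _ _ (transGen_covBy_of_lt hlt)
    exact mem_directionPairs_neighbours_of_cover hw hy hab.le hab.ne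
      fun t hat htb => hab.eq_or_eq hat htb

end Tight

end

end CoreGame

theorem mainTheorem6 {N : Type*} [Fintype N] [DecidableEq N] [Nonempty N]
    (w : Finset N → ℝ) (hw : IsSupermodularGame w)
    (y : N → ℝ) (hy : y ∈ (core w).extremePoints ℝ) :
    (∀ σ : Enumeration N, marginalVector w σ = y → weylChamber σ ⊆ normalCone (core w) y) ∧
    (∀ τ : Enumeration N, marginalVector w τ ≠ y →
      interior (weylChamber τ) ∩ normalCone (core w) y = ∅) ∧
    (normalCone (core w) y = ⋃ σ ∈ marginalFiber w y, weylChamber σ) ∧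
    IsPoset (commonPrecedence (marginalFiber w y)) ∧
    normalCone (core w) y = braidCone (commonPrecedence (marginalFiber w y)) ∧
    commonPrecedence (marginalFiber w y) =
      transClosure (directionPairs ((core w).extremePoints ℝ) y) ∧
    commonPrecedence (marginalFiber w y) =
      transClosure (directionPairs (neighbours (core w) y) y ∪ Set.diagonal N) := by
  have hT : ∀ p : N × N, p ∈ commonPrecedence (marginalFiber w y) ↔ TightLE w y p.1 p.2 :=
    fun p => (tightLE_iff_forall_le hw hy).symm
  -- The vertex `y` itself is allowed here, and `χ_u - χ_u = 0`; hence (e), unlike (f), needs no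
  -- added diagonal.
  have hdiag : ∀ u : N, (u, u) ∈ directionPairs ((core w).extremePoints ℝ) y :=
    fun u => ⟨y, hy, 1, one_pos, by simp⟩
  have hsub : directionPairs (neighbours (core w) y) y ∪ Set.diagonal N ⊆
      directionPairs ((core w).extremePoints ℝ) y := by
    rintro ⟨u, v⟩ (⟨z, hz, h⟩ | h)
    · exact ⟨z, hz.1, h⟩
    · obtain rfl : u = v := h
      exact hdiag u
  have hdir : ∀ u v, (u, v) ∈ directionPairs ((core w).extremePoints ℝ) y → TightLE w y u v :=
    fun u v h => tightLE_of_mem_directionPairs (fun z hz => hz.1) h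
  refine ⟨?_, ?_, normalCone_core_eq_iUnion hw hy, ⟨?_, ?_, ?_⟩,
    normalCone_core_eq_braidCone hw hy, ?_, ?_⟩
  · rintro σ rfl
    exact weylChamber_subset_normalCone hw
  · intro τ hτ
    rw [Set.eq_empty_iff_forall_notMem]
    rintro x ⟨hxτ, hx⟩
    rw [normalCone_core_eq_iUnion hw hy] at hx
    simp only [Set.mem_iUnion, exists_prop] at hx
    obtain ⟨σ, hσ, hxσ⟩ := hx
    exact hτ ((marginalVector_eq_of_mem_interior w hxτ hxσ).trans hσ)
  · exact fun u => (hT _).2 (TightLE.refl w y u)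
  · exact fun u v h1 h2 => ((hT _).1 h1).antisymm hy ((hT _).1 h2)
  · exact fun u v t h1 h2 => (hT _).2 (((hT _).1 h1).trans ((hT _).1 h2))
  · apply Set.Subset.antisymm
    · rintro ⟨u, v⟩ h
      exact Relation.TransGen.mono (fun a b hab => hsub hab) _ _
        (mem_transClosure_neighbours_of_tightLE hw hy ((hT _).1 h))
    · rintro ⟨u, v⟩ h
      exact (hT _).2 (transGen_tightLE hdir h)
  · apply Set.Subset.antisymm
    · rintro ⟨u, v⟩ h
      exact mem_transClosure_neighbours_of_tightLE hw hy ((hT _).1 h)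
    · rintro ⟨u, v⟩ h
      exact (hT _).2 (transGen_tightLE (fun a b hab => hdir a b (hsub hab)) h)
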